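/- **Deterministic stratified fragmentation.** Let $(p_n)_{n\ge1}$ be a sequence in $[0,1]$. Define break points $a_{n,k}$, $0\le k\le n+1$, by $a_{n,0}=0$, $a_{n,n+1}=1$ for $n\ge 0$, and $$a_{n,k}=p_n\,a_{n-1,k-1}+(1-p_n)\,a_{n-1,k},\qquad 1\le k\le n,\ n\ge1 ,$$ and set $\tilde g_n=\frac1n\sum_{k=1}^n\delta_{a_{n,k}^{1/n}}$. Assume that, for some probability measure $H$ on $[0,1]$ with $H(\{0,1\})<1$, we have $\frac1n\sum_{m=1}^n\delta_{p_m}\Rightarrow H$ weakly on $[0,1]$ as $n\to\infty$. Set $\bar p=\int_0^1 t\,H(dt)$ and $h=H(\{1\})$. Then: 1. $\bar p\in(0,1)$ and $h<\bar p$; and for all $\alpha\in(h,\bar p)$ there is a unique $\theta=\theta(\alpha)\in\mathbb R$ such that $$\int_0^1\frac{te^\theta}{1-t+te^\theta}\,H(dt)=\alpha .$$ 2. Define, for $\alpha\in(h,\bar p)$, $$I(\alpha)=\alpha\theta(\alpha)-\int_0^1\log\bigl(1-t+te^{\theta(\alpha)}\bigr)\,H(dt).$$ Then $I$ is continuous and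 strictly decreasing on $(h,\bar p)$, and $I(\alpha)\to0$ as $\alpha\uparrow\bar p$. The limit $I(h):=\lim_{\alpha\downarrow h}I(\alpha)$ exists in $(0,\infty]$. Put $I(\bar p)=0$ and $x_*=e^{-I(h)}\in[0,1)$. 3. For every $x\in[x_*,1]$ there is a unique $\alpha=\alpha_I(x)\in[h,\bar p]$ such that $I(\alpha)=\log(1/x)$ (with $\log(1/0)=\infty$). There is a unique probability measure $\tilde g$ on $[0,1]$ with $$\tilde g([0,x])=\begin{cases}h,&x\in[0,x_*],\\ \alpha_I(x),&x\in(x_*,1),\end{cases}$$ and $\tilde g_n\Rightarrow\tilde g$ weakly on $[0,1]$ as $n\to\infty$. In particular, when $H(\{1\})=0$ all of this holds with $h=0$, so $I$ is defined on $(0,\bar p)$ and $\tilde g([0,x])=0$ for $x\in[0,x_*]$. -/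

import Mathlib

open Set Filter Topology MeasureTheory
open scoped ENNReal

noncomputable section

namespace Fragmentation

/-- The break points `a n k` of the fragmentation-erasure process with splitting proportions
`p n k` (`1 ≤ k ≤ n`): `a n 0 = 0`, `a n (n + 1) = 1` and
`a n k = p n k * a (n - 1) (k - 1) + (1 - p n k) * a (n - 1) k` for `1 ≤ k ≤ n`.
Outside the relevant range, that is for `k > n + 1`, the value is `1`. -/
def breakPoint (p : ℕ → ℕ → unitInterval) : ℕ → ℕ → unitInterval
  | _, 0 => 0
  | 0, _ + 1 => 1
  | n + 1, k + 1 =>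
    if k + 1 ≤ n + 1 then
      ⟨(p (n + 1) (k + 1) : ℝ) * (breakPoint p n k : ℝ)
          + (1 - (p (n + 1) (k + 1) : ℝ)) * (breakPoint p n (k + 1) : ℝ),
        convex_Icc (0 : ℝ) 1 (breakPoint p n k).2 (breakPoint p n (k + 1)).2
          (p (n + 1) (k + 1)).2.1 (sub_nonneg.2 (p (n + 1) (k + 1)).2.2) (by ring)⟩
    else 1

theorem breakPoint_zero_right (p : ℕ → ℕ → unitInterval) (n : ℕ) : breakPoint p n 0 = 0 := by
  cases n <;> simp [breakPoint]

theorem breakPoint_last (p : ℕ → ℕ → unitInterval) (n : ℕ) :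
    breakPoint p n (n + 1) = 1 := by
  cases n <;> simp [breakPoint]

theorem breakPoint_rec (p : ℕ → ℕ → unitInterval) (n k : ℕ) (hk : k ≤ n) :
    (breakPoint p (n + 1) (k + 1) : ℝ)
      = (p (n + 1) (k + 1) : ℝ) * (breakPoint p n k : ℝ)
        + (1 - (p (n + 1) (k + 1) : ℝ)) * (breakPoint p n (k + 1) : ℝ) := by
  simp [breakPoint, hk]

/-- The break points of the stratified fragmentation: `p n k = p n` for all `k`. -/
def stratBreakPoint (p : ℕ → unitInterval) : ℕ → ℕ → unitInterval :=
  breakPoint fun n _ => p n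

/-- The `n`-th root `x ^ (1 / n)` of a point of `[0, 1]`. -/
def root (n : ℕ) (x : unitInterval) : unitInterval :=
  ⟨(x : ℝ) ^ (1 / (n : ℝ)), Real.rpow_nonneg x.2.1 _,
    Real.rpow_le_one x.2.1 x.2.2 (by positivity)⟩

/-- The empirical distribution `(1 / n) ∑ δ_{x k}` of `n ≥ 1` points of `[0, 1]`. -/
def empirical {n : ℕ} [NeZero n] (x : Fin n → unitInterval) :
    ProbabilityMeasure unitInterval :=
  ⟨(n : ℝ≥0∞)⁻¹ • ∑ k : Fin n, Measure.dirac (x k), ⟨by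
    have h0 : (n : ℝ≥0∞) ≠ 0 := by exact_mod_cast NeZero.ne n
    simp [ENNReal.inv_mul_cancel h0 (ENNReal.natCast_ne_top n)]⟩⟩

/-- The empirical distribution of the splitting proportions `p 1, …, p n`. -/
def propEmpirical (p : ℕ → unitInterval) (n : ℕ) [NeZero n] : ProbabilityMeasure unitInterval :=
  empirical fun m : Fin n => p (m + 1)

/-- The transformed empirical distribution of the break points: the empirical distribution of
`(a n k) ^ (1 / n)`, `k = 1, …, n`. -/
def transformedEmpirical (p : ℕ → unitInterval) (n : ℕ) [NeZero n] :
    ProbabilityMeasure unitInterval :=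
  empirical fun k : Fin n => root n (stratBreakPoint p n (k + 1))

variable (H : ProbabilityMeasure unitInterval)

/-- The mean `p̄ = ∫ t H(dt)`. -/
def mean : ℝ := ∫ t : unitInterval, (t : ℝ) ∂(H : Measure unitInterval)

/-- The mass `H({1})` of the right endpoint. -/
def massOne : ℝ := (H : Measure unitInterval).real {1}

/-- The function `θ ↦ ∫ t e^θ / (1 - t + t e^θ) H(dt)`. -/
def tiltedMean (θ : ℝ) : ℝ :=
  ∫ t : unitInterval, (t : ℝ) * Real.exp θ / (1 - (t : ℝ) + (t : ℝ) * Real.exp θ)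
    ∂(H : Measure unitInterval)

/-- The solution `θ(α)` of the equation `tiltedMean H θ = α` (meaningful when there is exactly
one). -/
def theta (α : ℝ) : ℝ := Classical.epsilon fun θ : ℝ => tiltedMean H θ = α

/-- The rate function `I(α) = α θ(α) - ∫ log (1 - t + t e^{θ(α)}) H(dt)`. -/
def rate (α : ℝ) : ℝ :=
  α * theta H α
    - ∫ t : unitInterval, Real.log (1 - (t : ℝ) + (t : ℝ) * Real.exp (theta H α))
        ∂(H : Measure unitInterval)

/-- The limit of `I(α)`, in `[-∞, ∞]`, as `α` decreases to `H({1})`. -/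
def rateLeft : EReal := limUnder (𝓝[>] massOne H) fun α : ℝ => (rate H α : EReal)

/-- The rate function extended to the closed interval `[H({1}), p̄]`: at the left endpoint by its
limit, and at `p̄` by `0`. -/
def extRate (α : ℝ) : EReal :=
  if α ≤ massOne H then rateLeft H else if α < mean H then (rate H α : EReal) else 0

/-- The point `x_* = exp (-I(H({1})))`, with `exp (-∞) = 0`. -/
def xStar : ℝ := (EReal.exp (-rateLeft H)).toReal

/-- `α` lies in `[H({1}), p̄]` and solves `I(α) = log (1 / x)`, with `log (1 / 0) = ∞`. -/
def SolvesRate (x α : ℝ) : Prop :=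
  α ∈ Icc (massOne H) (mean H) ∧ extRate H α = ENNReal.log (ENNReal.ofReal x)⁻¹

/-- The solution `α_I(x)` of `I(α) = log (1 / x)` in `[H({1}), p̄]` (meaningful when there is
exactly one). -/
def alphaI (x : ℝ) : ℝ := Classical.epsilon fun α : ℝ => SolvesRate H x α

/-- `g` has the distribution function `g([0, x]) = H({1})` for `x ∈ [0, x_*]` and
`g([0, x]) = α_I(x)` for `x ∈ (x_*, 1)`. -/
def IsLimitLaw (g : ProbabilityMeasure unitInterval) : Prop :=
  ∀ x : unitInterval,
    ((x : ℝ) ≤ xStar H → (g : Measure unitInterval).real (Icc 0 x) = massOne H) ∧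
    (xStar H < (x : ℝ) → (x : ℝ) < 1 →
      (g : Measure unitInterval).real (Icc 0 x) = alphaI H x)

end Fragmentation

end

/-! Let `S_n` be a sum of independent Bernoulli variables with parameters `p 1, …, p n`.
Conditioning on the last variable turns the recursion into `a_{n,k} = P(S_n < k)`, so the theorem is
a large deviation statement for the lower tail of `S_n`. No probability space is built: each
inequality is proved by induction along the recursion.

Weak convergence gives `(1/n) log E e^{θ S_n} → Λ(θ)`, where `Λ` is `logMgf` (`tendsto_log_sumMgf`).
The Chernoff bound (`stratBreakPoint_mul_exp_le`) and Cramér's change of measure (`sumMgf_le`) then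
show that `a_{n,k}^{1/n}` tends to `e^{-I(u)}` when `k/n → u` lies in `(h, p̄)`, to `0` for `u < h`
and to `1` for `u ≥ p̄` (`tendsto_root_stratBreakPoint`). This limit is `quantile`.

The integral of `f` against `g̃_n` is that of `f(a_{n,⌊nu⌋+1}^{1/n})` over uniform `u` in `(0, 1]`.
Dominated convergence yields the law of `quantile` at a uniform point, and inverting `quantile`
gives its distribution function.

The properties of `I` come from Legendre duality: the tangent inequality `logMgf_ge` makes `I` a
supremum of affine functions, attained at `θ(α) < 0`. -/

noncomputable section

namespace Fragmentation

/-! ### Tilted means and the rate function -/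

section

/-- The moment generating function `1 - t + t * exp θ` of the Bernoulli law with parameter `t`. -/
def bernoulliMgf (θ t : ℝ) : ℝ := 1 - t + t * Real.exp θ

theorem bernoulliMgf_zero (t : ℝ) : bernoulliMgf 0 t = 1 := by simp [bernoulliMgf]

theorem bernoulliMgf_pos (θ : ℝ) (t : unitInterval) : 0 < bernoulliMgf θ t := by
  have h0 := t.2.1
  have h1 := t.2.2
  have h := Real.exp_pos θ
  unfold bernoulliMgf
  rcases h0.eq_or_lt with h2 | h2
  · rw [← h2]; norm_num
  · nlinarith [mul_pos h2 h]

theorem continuous_bernoulliMgf (θ : ℝ) :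
    Continuous fun t : unitInterval => bernoulliMgf θ t := by
  unfold bernoulliMgf; fun_prop

/-- The parameter `t * exp θ / (1 - t + t * exp θ)` of the tilted Bernoulli law. -/
def tilt (θ t : ℝ) : ℝ := t * Real.exp θ / (1 - t + t * Real.exp θ)

theorem tilt_eq (θ t : ℝ) : tilt θ t = t * Real.exp θ / bernoulliMgf θ t := rfl

theorem tilt_nonneg (θ : ℝ) (t : unitInterval) : 0 ≤ tilt θ t :=
  div_nonneg (mul_nonneg t.2.1 (Real.exp_pos θ).le) (bernoulliMgf_pos θ t).le

theorem tilt_le_one (θ : ℝ) (t : unitInterval) : tilt θ t ≤ 1 := by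
  rw [tilt_eq, div_le_one (bernoulliMgf_pos θ t), bernoulliMgf]
  linarith [t.2.2]

theorem norm_tilt_le_one (θ : ℝ) (t : unitInterval) : ‖tilt θ t‖ ≤ 1 := by
  rw [Real.norm_of_nonneg (tilt_nonneg θ t)]; exact tilt_le_one θ t

theorem tilt_le_tilt {θ η : ℝ} (h : θ ≤ η) (t : unitInterval) : tilt θ t ≤ tilt η t := by
  rw [tilt_eq, tilt_eq, div_le_div_iff₀ (bernoulliMgf_pos θ t) (bernoulliMgf_pos η t)]
  have h1 := Real.exp_le_exp.2 h
  have h2 := mul_nonneg t.2.1 (sub_nonneg.2 t.2.2)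
  unfold bernoulliMgf
  nlinarith

theorem tilt_lt_tilt {θ η : ℝ} (h : θ < η) {t : unitInterval} (h0 : (0 : ℝ) < t)
    (h1 : (t : ℝ) < 1) : tilt θ t < tilt η t := by
  rw [tilt_eq, tilt_eq, div_lt_div_iff₀ (bernoulliMgf_pos θ t) (bernoulliMgf_pos η t)]
  have h1 := Real.exp_lt_exp.2 h
  have h2 := mul_pos h0 (sub_pos.2 ‹(t : ℝ) < 1›)
  unfold bernoulliMgf
  nlinarith

theorem continuous_tilt (θ : ℝ) : Continuous fun t : unitInterval => tilt θ t := by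
  simp only [tilt_eq]
  exact (by fun_prop : Continuous fun t : unitInterval => (t : ℝ) * Real.exp θ).div
    (continuous_bernoulliMgf θ) fun t => (bernoulliMgf_pos θ t).ne'

theorem continuous_tilt_left (t : unitInterval) : Continuous fun θ : ℝ => tilt θ t := by
  simp only [tilt_eq]
  refine (by fun_prop : Continuous fun θ : ℝ => (t : ℝ) * Real.exp θ).div ?_
    fun θ => (bernoulliMgf_pos θ t).ne'
  unfold bernoulliMgf; fun_prop

/-- The tangent line of the convex function `θ ↦ log (1 - t + t * exp θ)`. -/
theorem log_bernoulliMgf_ge (θ η : ℝ) (t : unitInterval) :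
    Real.log (bernoulliMgf θ t) + (η - θ) * tilt θ t ≤ Real.log (bernoulliMgf η t) := by
  have hθ := bernoulliMgf_pos θ t
  have hη := bernoulliMgf_pos η t
  have hq := tilt_nonneg θ t
  have hq' := tilt_le_one θ t
  -- Jensen for `exp` under the Bernoulli law with the tilted parameter; the quotient on the right
  -- is its moment generating function at `η - θ`.
  have key : Real.exp ((η - θ) * tilt θ t) ≤ bernoulliMgf η t / bernoulliMgf θ t := by
    have h := convexOn_exp.2 (mem_univ 0) (mem_univ (η - θ)) (sub_nonneg.2 hq') hq (by ring)
    simp only [smul_eq_mul, mul_zero, zero_add, Real.exp_zero, mul_one] at h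
    rw [mul_comm]
    refine h.trans_eq ?_
    rw [tilt_eq, Real.exp_sub]
    have := (Real.exp_pos θ).ne'
    field_simp
    simp only [bernoulliMgf]
    ring
  rw [← Real.le_log_iff_exp_le (by positivity), Real.log_div hη.ne' hθ.ne'] at key
  linarith

variable (H : ProbabilityMeasure unitInterval)

theorem integrable_of_continuous {f : unitInterval → ℝ} (hf : Continuous f) :
    Integrable f (H : Measure unitInterval) :=
  integrableOn_univ.1 (hf.continuousOn.integrableOn_compact isCompact_univ)

/-- The integrated logarithmic moment generating function. -/
def logMgf (θ : ℝ) : ℝ :=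
  ∫ t : unitInterval, Real.log (bernoulliMgf θ t) ∂(H : Measure unitInterval)

theorem continuous_log_bernoulliMgf (θ : ℝ) :
    Continuous fun t : unitInterval => Real.log (bernoulliMgf θ t) :=
  (continuous_bernoulliMgf θ).log fun t => (bernoulliMgf_pos θ t).ne'

theorem tiltedMean_eq (θ : ℝ) :
    tiltedMean H θ = ∫ t : unitInterval, tilt θ t ∂(H : Measure unitInterval) := rfl

theorem rate_eq (α : ℝ) : rate H α = α * theta H α - logMgf H (theta H α) := rfl

theorem tiltedMean_zero : tiltedMean H 0 = mean H := by
  simp [tiltedMean, mean]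

theorem logMgf_zero : logMgf H 0 = 0 := by simp [logMgf, bernoulliMgf_zero]

theorem logMgf_ge (θ η : ℝ) :
    logMgf H θ + (η - θ) * tiltedMean H θ ≤ logMgf H η := by
  unfold logMgf
  rw [tiltedMean_eq, ← integral_const_mul, ← integral_add
    (integrable_of_continuous H (continuous_log_bernoulliMgf θ))
    ((integrable_of_continuous H (continuous_tilt θ)).const_mul _)]
  exact integral_mono (((integrable_of_continuous H (continuous_log_bernoulliMgf θ))).add
    ((integrable_of_continuous H (continuous_tilt θ)).const_mul _))
    (integrable_of_continuous H (continuous_log_bernoulliMgf η))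
    fun t => log_bernoulliMgf_ge θ η t

theorem integral_indicator_one :
    ∫ t : unitInterval, ({1} : Set unitInterval).indicator 1 t ∂(H : Measure unitInterval)
      = massOne H :=
  MeasureTheory.integral_indicator_one (measurableSet_singleton _)

/-- For `θ ≤ 0` the integrand is at most `0`, and it equals `θ` at `t = 1`. This controls the regime
`u < h`, where no `θ(u)` exists. -/
theorem logMgf_le {θ : ℝ} (hθ : θ ≤ 0) : logMgf H θ ≤ θ * massOne H := by
  rw [← integral_indicator_one H, ← integral_const_mul]
  refine integral_mono (integrable_of_continuous H (continuous_log_bernoulliMgf θ))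
    (((integrable_const 1).indicator (measurableSet_singleton _)).const_mul _) fun t => ?_
  rcases eq_or_ne t 1 with rfl | ht
  · simp [bernoulliMgf]
  · have h1 : bernoulliMgf θ t ≤ 1 := by
      unfold bernoulliMgf
      nlinarith [t.2.1, Real.exp_le_one_iff.2 hθ]
    simpa [ht] using Real.log_nonpos (bernoulliMgf_pos θ t).le h1

theorem continuous_tiltedMean : Continuous (tiltedMean H) :=
  continuous_of_dominated (bound := fun _ => 1)
    (fun θ => (continuous_tilt θ).aestronglyMeasurable)
    (fun θ => ae_of_all _ fun t => norm_tilt_le_one θ t)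
    (integrable_const _) (ae_of_all _ continuous_tilt_left)

/-- As `θ → -∞` the tilted parameter vanishes for every `t ≠ 1` and stays `1` at `t = 1`; this is
why `h` is the left endpoint. -/
theorem tendsto_tiltedMean_atBot : Tendsto (tiltedMean H) atBot (𝓝 (massOne H)) := by
  rw [← integral_indicator_one H]
  refine tendsto_integral_filter_of_dominated_convergence (fun _ => 1)
    (Eventually.of_forall fun θ => (continuous_tilt θ).aestronglyMeasurable)
    (Eventually.of_forall fun θ => ae_of_all _ fun t => norm_tilt_le_one θ t)
    (integrable_const _) (ae_of_all _ fun t => ?_)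
  rcases eq_or_ne t 1 with rfl | ht
  · refine tendsto_const_nhds.congr fun θ => ?_
    simp
  · have h1 : (1 : ℝ) - t ≠ 0 := fun h => ht (Subtype.ext (by simpa using (sub_eq_zero.1 h).symm))
    have h2 : Tendsto (fun θ : ℝ => (t : ℝ) * Real.exp θ) atBot (𝓝 0) := by
      simpa using Real.tendsto_exp_atBot.const_mul (t : ℝ)
    have h3 := h2.div (h2.const_add (1 - (t : ℝ))) (by simpa using h1)
    simpa [ht, Pi.div_def] using h3

variable {H}

/-- Tilting moves every parameter strictly between `0` and `1`, and by hypothesis `H` charges these.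
-/
theorem tiltedMean_strictMono (hH : (H : Measure unitInterval) {0, 1} < 1) :
    StrictMono (tiltedMean H) := by
  intro θ η h
  have hint := (integrable_of_continuous H (continuous_tilt η)).sub
    (integrable_of_continuous H (continuous_tilt θ))
  rw [tiltedMean_eq, tiltedMean_eq, ← sub_pos, ← integral_sub
    (integrable_of_continuous H (continuous_tilt η))
    (integrable_of_continuous H (continuous_tilt θ))]
  refine (integral_pos_iff_support_of_nonneg (fun t => sub_nonneg.2 (tilt_le_tilt h.le t))
    hint).2 (pos_iff_ne_zero.2 fun h0 => hH.ne ?_)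
  rw [← prob_compl_eq_zero_iff (by measurability)]
  refine measure_mono_null (fun t ht => ?_) h0
  simp only [mem_compl_iff, mem_insert_iff, mem_singleton_iff, not_or] at ht
  exact (sub_pos.2 <| tilt_lt_tilt h (unitInterval.pos_iff_ne_zero.2 ht.1) (unitInterval.lt_one_iff_ne_one.2 ht.2)).ne'

theorem massOne_lt_tiltedMean (hH : (H : Measure unitInterval) {0, 1} < 1) (θ : ℝ) :
    massOne H < tiltedMean H θ :=
  ((tiltedMean_strictMono hH).monotone.le_of_tendsto (tendsto_tiltedMean_atBot H) (θ - 1)).trans_lt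
    (tiltedMean_strictMono hH (by linarith))

theorem massOne_lt_mean (hH : (H : Measure unitInterval) {0, 1} < 1) : massOne H < mean H :=
  tiltedMean_zero H ▸ massOne_lt_tiltedMean hH 0

theorem massOne_nonneg : 0 ≤ massOne H := measureReal_nonneg

theorem mean_lt_one (hH : (H : Measure unitInterval) {0, 1} < 1) : mean H < 1 := by
  rw [← tiltedMean_zero]
  refine (tiltedMean_strictMono hH zero_lt_one).trans_le ?_
  refine (integral_mono (integrable_of_continuous H (continuous_tilt 1)) (integrable_const 1)
    fun t => tilt_le_one 1 t).trans_eq (by simp)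

theorem existsUnique_tiltedMean_eq (hH : (H : Measure unitInterval) {0, 1} < 1) {α : ℝ}
    (hα : α ∈ Ioo (massOne H) (mean H)) : ∃! θ : ℝ, tiltedMean H θ = α := by
  obtain ⟨η, hη⟩ := ((tendsto_tiltedMean_atBot H).eventually_lt_const hα.1).exists
  obtain ⟨θ, hθ⟩ := mem_range_of_exists_le_of_exists_ge (continuous_tiltedMean H) ⟨η, hη.le⟩
    ⟨0, (tiltedMean_zero H).symm ▸ hα.2.le⟩
  exact ⟨θ, hθ, fun ζ hζ => (tiltedMean_strictMono hH).injective (hζ.trans hθ.symm)⟩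

theorem tiltedMean_theta (hH : (H : Measure unitInterval) {0, 1} < 1) {α : ℝ}
    (hα : α ∈ Ioo (massOne H) (mean H)) : tiltedMean H (theta H α) = α :=
  Classical.epsilon_spec (existsUnique_tiltedMean_eq hH hα).exists

theorem theta_neg (hH : (H : Measure unitInterval) {0, 1} < 1) {α : ℝ}
    (hα : α ∈ Ioo (massOne H) (mean H)) : theta H α < 0 := by
  rw [← (tiltedMean_strictMono hH).lt_iff_lt, tiltedMean_theta hH hα, tiltedMean_zero]
  exact hα.2

theorem theta_lt_theta (hH : (H : Measure unitInterval) {0, 1} < 1) {α β : ℝ}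
    (hα : α ∈ Ioo (massOne H) (mean H)) (hβ : β ∈ Ioo (massOne H) (mean H)) (h : α < β) :
    theta H α < theta H β := by
  rwa [← (tiltedMean_strictMono hH).lt_iff_lt, tiltedMean_theta hH hα, tiltedMean_theta hH hβ]

/-- The rate function is the Legendre transform of `logMgf`. -/
theorem le_rate (hH : (H : Measure unitInterval) {0, 1} < 1) {α : ℝ}
    (hα : α ∈ Ioo (massOne H) (mean H)) (η : ℝ) : α * η - logMgf H η ≤ rate H α := by
  have := logMgf_ge H (theta H α) η
  rw [tiltedMean_theta hH hα] at this
  rw [rate_eq]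
  linarith

/-- Testing the supremum at `θ(β)` gives `I(α) ≥ I(β) + (α - β) θ(β)`, and both factors of the
product are negative. -/
theorem rate_strictAntiOn (hH : (H : Measure unitInterval) {0, 1} < 1) :
    StrictAntiOn (rate H) (Ioo (massOne H) (mean H)) := by
  intro α hα β hβ h
  have h1 := le_rate hH hα (theta H β)
  have h2 := mul_neg_of_pos_of_neg (sub_pos.2 h) (theta_neg hH hβ)
  rw [rate_eq H β]
  linarith

/-- A supremum of affine functions is convex. Continuity of `I` on the open interval follows, with
no need for continuity of `θ(α)`. -/
theorem rate_convexOn (hH : (H : Measure unitInterval) {0, 1} < 1) :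
    ConvexOn ℝ (Ioo (massOne H) (mean H)) (rate H) := by
  refine ⟨convex_Ioo _ _, fun α hα β hβ a b ha hb hab => ?_⟩
  have h1 := le_rate hH hα (theta H (a • α + b • β))
  have h2 := le_rate hH hβ (theta H (a • α + b • β))
  rw [rate_eq]
  simp only [smul_eq_mul] at *
  have h3 := mul_le_mul_of_nonneg_left h1 ha
  have h4 := mul_le_mul_of_nonneg_left h2 hb
  have h5 : logMgf H (theta H (a * α + b * β))
      = a * logMgf H (theta H (a * α + b * β)) + b * logMgf H (theta H (a * α + b * β)) := by
    rw [← add_mul, hab, one_mul]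
  rw [h5]
  linarith

theorem rate_continuousOn (hH : (H : Measure unitInterval) {0, 1} < 1) :
    ContinuousOn (rate H) (Ioo (massOne H) (mean H)) :=
  (rate_convexOn hH).continuousOn isOpen_Ioo

theorem rate_nonneg (hH : (H : Measure unitInterval) {0, 1} < 1) {α : ℝ}
    (hα : α ∈ Ioo (massOne H) (mean H)) : 0 ≤ rate H α := by
  simpa [logMgf_zero] using le_rate hH hα 0

theorem rate_pos (hH : (H : Measure unitInterval) {0, 1} < 1) {α : ℝ}
    (hα : α ∈ Ioo (massOne H) (mean H)) : 0 < rate H α := by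
  obtain ⟨β, hβ⟩ := exists_between hα.2
  have hβ' : β ∈ Ioo (massOne H) (mean H) := ⟨hα.1.trans hβ.1, hβ.2⟩
  exact (rate_nonneg hH hβ').trans_lt (rate_strictAntiOn hH hα hβ' hβ.1)

theorem tendsto_rate_mean (hH : (H : Measure unitInterval) {0, 1} < 1) :
    Tendsto (rate H) (𝓝[<] mean H) (𝓝 0) := by
  obtain ⟨β, hβ⟩ := exists_between (massOne_lt_mean hH)
  have hup : Tendsto (fun α => (α - mean H) * theta H β) (𝓝[<] mean H) (𝓝 0) := by
    have : Continuous fun α : ℝ => (α - mean H) * theta H β := by fun_prop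
    simpa using (this.tendsto (mean H)).mono_left nhdsWithin_le_nhds
  refine tendsto_of_tendsto_of_tendsto_of_le_of_le' tendsto_const_nhds hup ?_ ?_
  · filter_upwards [Ioo_mem_nhdsLT (massOne_lt_mean hH)] with α hα using rate_nonneg hH hα
  · filter_upwards [Ioo_mem_nhdsLT hβ.2] with α hα
    have hα' : α ∈ Ioo (massOne H) (mean H) := ⟨hβ.1.trans hα.1, hα.2⟩
    -- The tangent of `Λ` at `0` gives `I(α) ≤ (α - p̄) θ(α)`; for `α > β` monotonicity replaces
    -- `θ(α)` by the fixed `θ(β)`.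
    have h1 := logMgf_ge H 0 (theta H α)
    rw [logMgf_zero, tiltedMean_zero] at h1
    have h2 := mul_nonneg (sub_nonneg.2 (theta_lt_theta hH hβ hα' hα.1).le)
      (sub_nonneg.2 hα.2.le)
    rw [rate_eq]
    linarith

end

/-! ### The extended rate function and its inverse -/

section

variable {H : ProbabilityMeasure unitInterval}

/-- A monotone function has one-sided limits in `EReal`, so the `limUnder` defining `rateLeft` is a
genuine limit. -/
theorem tendsto_rate_rateLeft (hH : (H : Measure unitInterval) {0, 1} < 1) :
    Tendsto (fun α : ℝ => (rate H α : EReal)) (𝓝[>] massOne H) (𝓝 (rateLeft H)) := by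
  have hanti : AntitoneOn (fun α : ℝ => (rate H α : EReal)) (Ioo (massOne H) (mean H)) :=
    fun α hα β hβ h => EReal.coe_le_coe_iff.2 ((rate_strictAntiOn hH).antitoneOn hα hβ h)
  exact tendsto_nhds_limUnder ⟨_, hanti.tendsto_nhdsWithin_Ioo_right
    (nonempty_Ioo.2 (massOne_lt_mean hH)) (OrderTop.bddAbove _)⟩

theorem rate_lt_rateLeft (hH : (H : Measure unitInterval) {0, 1} < 1) {α : ℝ}
    (hα : α ∈ Ioo (massOne H) (mean H)) : (rate H α : EReal) < rateLeft H := by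
  obtain ⟨β, hβ⟩ := exists_between hα.1
  have hβ' : β ∈ Ioo (massOne H) (mean H) := ⟨hβ.1, hβ.2.trans hα.2⟩
  refine (EReal.coe_lt_coe_iff.2 (rate_strictAntiOn hH hβ' hα hβ.2)).trans_le ?_
  refine ge_of_tendsto (tendsto_rate_rateLeft hH) ?_
  filter_upwards [Ioo_mem_nhdsGT hβ.1] with γ hγ
  exact EReal.coe_le_coe_iff.2
    (rate_strictAntiOn hH ⟨hγ.1, hγ.2.trans hβ'.2⟩ hβ' hγ.2).le

theorem rateLeft_pos (hH : (H : Measure unitInterval) {0, 1} < 1) : 0 < rateLeft H := by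
  obtain ⟨β, hβ⟩ := exists_between (massOne_lt_mean hH)
  exact (EReal.coe_nonneg.2 (rate_nonneg hH hβ)).trans_lt (rate_lt_rateLeft hH hβ)

theorem extRate_massOne : extRate H (massOne H) = rateLeft H := by simp [extRate]

theorem extRate_of_mem {α : ℝ} (hα : α ∈ Ioo (massOne H) (mean H)) :
    extRate H α = rate H α := by
  simp [extRate, hα.1.not_ge, hα.2]

theorem extRate_mean (hH : (H : Measure unitInterval) {0, 1} < 1) : extRate H (mean H) = 0 := by
  simp [extRate, (massOne_lt_mean hH).not_ge]

theorem extRate_strictAntiOn (hH : (H : Measure unitInterval) {0, 1} < 1) :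
    StrictAntiOn (extRate H) (Icc (massOne H) (mean H)) := by
  intro α hα β hβ h
  rcases hα.1.eq_or_lt with rfl | hα1
  · rw [extRate_massOne]
    rcases hβ.2.eq_or_lt with rfl | hβ2
    · rw [extRate_mean hH]; exact rateLeft_pos hH
    · rw [extRate_of_mem ⟨h, hβ2⟩]; exact rate_lt_rateLeft hH ⟨h, hβ2⟩
  · have hα' : α ∈ Ioo (massOne H) (mean H) := ⟨hα1, h.trans_le hβ.2⟩
    rw [extRate_of_mem hα']
    rcases hβ.2.eq_or_lt with rfl | hβ2
    · rw [extRate_mean hH]; exact EReal.coe_pos.2 (rate_pos hH hα')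
    · rw [extRate_of_mem ⟨hα1.trans h, hβ2⟩]
      exact EReal.coe_lt_coe_iff.2 (rate_strictAntiOn hH hα' ⟨hα1.trans h, hβ2⟩ h)

theorem xStar_lt_one (hH : (H : Measure unitInterval) {0, 1} < 1) : xStar H < 1 := by
  have h : EReal.exp (-rateLeft H) < 1 := by
    rw [EReal.exp_lt_one_iff, EReal.neg_lt_comm, neg_zero]
    exact rateLeft_pos hH
  exact ENNReal.toReal_lt_of_lt_ofReal (by simpa using h)

theorem xStar_nonneg : 0 ≤ xStar H := ENNReal.toReal_nonneg

theorem log_inv_xStar (hH : (H : Measure unitInterval) {0, 1} < 1) :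
    ENNReal.log (ENNReal.ofReal (xStar H))⁻¹ = rateLeft H := by
  have h : EReal.exp (-rateLeft H) ≠ ⊤ := by
    simpa using ((EReal.bot_lt_zero).trans (rateLeft_pos hH)).ne'
  rw [xStar, ENNReal.ofReal_toReal h, ENNReal.log_inv, EReal.log_exp, neg_neg]

theorem log_inv_ofReal {x : ℝ} (hx : 0 < x) :
    ENNReal.log (ENNReal.ofReal x)⁻¹ = ((-Real.log x : ℝ) : EReal) := by
  rw [ENNReal.log_inv, ENNReal.log_ofReal_of_pos hx, EReal.coe_neg]

theorem rateLeft_le_log_inv_iff (hH : (H : Measure unitInterval) {0, 1} < 1) {x : ℝ} :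
    rateLeft H ≤ ENNReal.log (ENNReal.ofReal x)⁻¹ ↔ x ≤ xStar H := by
  rw [← log_inv_xStar hH, ENNReal.log_le_log_iff, ENNReal.inv_le_inv,
    ENNReal.ofReal_le_ofReal_iff xStar_nonneg]

theorem xStar_lt_exp_neg_rate (hH : (H : Measure unitInterval) {0, 1} < 1) {α : ℝ}
    (hα : α ∈ Ioo (massOne H) (mean H)) : xStar H < Real.exp (-rate H α) := by
  rw [← not_le, ← rateLeft_le_log_inv_iff hH, not_le, log_inv_ofReal (Real.exp_pos _),
    Real.log_exp, neg_neg]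
  exact rate_lt_rateLeft hH hα

theorem exists_rate_eq (hH : (H : Measure unitInterval) {0, 1} < 1) {y : ℝ} (h0 : 0 < y)
    (hy : (y : EReal) < rateLeft H) : ∃ α ∈ Ioo (massOne H) (mean H), rate H α = y := by
  obtain ⟨α, hα, hα'⟩ := (((tendsto_rate_rateLeft hH).eventually_const_lt hy).and
    (Ioo_mem_nhdsGT (massOne_lt_mean hH))).exists
  obtain ⟨β, hβ, hβ'⟩ := (((tendsto_rate_mean hH).eventually_lt_const h0).and
    (Ioo_mem_nhdsLT (massOne_lt_mean hH))).exists
  exact isPreconnected_Ioo.intermediate_value hβ' hα' (rate_continuousOn hH)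
    ⟨hβ.le, (EReal.coe_lt_coe_iff.1 hα).le⟩

/-- Inside `(x_*, 1)` the equation `I(α) = log (1 / x)` has a solution in the open interval. -/
theorem exists_solvesRate_mem_Ioo (hH : (H : Measure unitInterval) {0, 1} < 1) {x : ℝ}
    (hx : x ∈ Ioo (xStar H) 1) :
    ∃ α ∈ Ioo (massOne H) (mean H), rate H α = -Real.log x ∧ SolvesRate H x α := by
  have hx0 : 0 < x := xStar_nonneg.trans_lt hx.1
  have hlt : ((-Real.log x : ℝ) : EReal) < rateLeft H := by
    rw [← log_inv_ofReal hx0, ← not_le, rateLeft_le_log_inv_iff hH]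
    exact hx.1.not_ge
  obtain ⟨α, hα, h⟩ := exists_rate_eq hH (neg_pos.2 (Real.log_neg hx0 hx.2)) hlt
  exact ⟨α, hα, h, Ioo_subset_Icc_self hα, by rw [extRate_of_mem hα, h, log_inv_ofReal hx0]⟩

theorem existsUnique_solvesRate (hH : (H : Measure unitInterval) {0, 1} < 1) {x : ℝ}
    (hx : x ∈ Icc (xStar H) 1) : ∃! α : ℝ, SolvesRate H x α := by
  refine existsUnique_of_exists_of_unique ?_ fun α β hα hβ =>
    (extRate_strictAntiOn hH).injOn hα.1 hβ.1 (hα.2.trans hβ.2.symm)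
  rcases hx.1.eq_or_lt with rfl | h1
  · exact ⟨massOne H, left_mem_Icc.2 (massOne_lt_mean hH).le,
      by rw [extRate_massOne, log_inv_xStar hH]⟩
  rcases hx.2.eq_or_lt with rfl | h2
  · exact ⟨mean H, right_mem_Icc.2 (massOne_lt_mean hH).le, by simp [extRate_mean hH]⟩
  obtain ⟨α, -, -, h⟩ := exists_solvesRate_mem_Ioo hH ⟨h1, h2⟩
  exact ⟨α, h⟩

theorem alphaI_spec (hH : (H : Measure unitInterval) {0, 1} < 1) {x : ℝ}
    (hx : x ∈ Ioo (xStar H) 1) :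
    alphaI H x ∈ Ioo (massOne H) (mean H) ∧ Real.exp (-rate H (alphaI H x)) = x := by
  obtain ⟨α, hα, h, hs⟩ := exists_solvesRate_mem_Ioo hH hx
  have heq : alphaI H x = α := (existsUnique_solvesRate hH (Ioo_subset_Icc_self hx)).unique
    (Classical.epsilon_spec (p := fun α => SolvesRate H x α) ⟨α, hs⟩) hs
  rw [heq, h, neg_neg, Real.exp_log (xStar_nonneg.trans_lt hx.1)]
  exact ⟨hα, rfl⟩

/-! ### The quantile function and the limit law -/

/-- The quantile function of the limit law. -/
def quantile (H : ProbabilityMeasure unitInterval) (u : ℝ) : ℝ :=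
  if u ≤ massOne H then 0 else if u < mean H then Real.exp (-rate H u) else 1

theorem quantile_of_le {u : ℝ} (hu : u ≤ massOne H) : quantile H u = 0 := by simp [quantile, hu]

theorem quantile_of_mem {u : ℝ} (hu : u ∈ Ioo (massOne H) (mean H)) :
    quantile H u = Real.exp (-rate H u) := by
  simp [quantile, hu.1.not_ge, hu.2]

theorem quantile_of_ge (hH : (H : Measure unitInterval) {0, 1} < 1) {u : ℝ} (hu : mean H ≤ u) :
    quantile H u = 1 := by
  simp [quantile, ((massOne_lt_mean hH).trans_le hu).not_ge, hu.not_gt]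

theorem quantile_mem (hH : (H : Measure unitInterval) {0, 1} < 1) (u : ℝ) :
    quantile H u ∈ Icc (0 : ℝ) 1 := by
  rcases le_or_gt u (massOne H) with h | h
  · simp [quantile_of_le h]
  rcases lt_or_ge u (mean H) with h' | h'
  · rw [quantile_of_mem ⟨h, h'⟩]
    exact ⟨(Real.exp_pos _).le, Real.exp_le_one_iff.2 (neg_nonpos.2 (rate_nonneg hH ⟨h, h'⟩))⟩
  · simp [quantile_of_ge hH h']

theorem quantile_monotone (hH : (H : Measure unitInterval) {0, 1} < 1) :
    Monotone (quantile H) := by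
  intro u v huv
  rcases le_or_gt u (massOne H) with h | h
  · rw [quantile_of_le h]; exact (quantile_mem hH v).1
  rcases lt_or_ge v (mean H) with h' | h'
  · have hu : u ∈ Ioo (massOne H) (mean H) := ⟨h, huv.trans_lt h'⟩
    have hv : v ∈ Ioo (massOne H) (mean H) := ⟨h.trans_le huv, h'⟩
    rw [quantile_of_mem hu, quantile_of_mem hv]
    exact Real.exp_le_exp.2 (neg_le_neg ((rate_strictAntiOn hH).antitoneOn hu hv huv))
  · rw [quantile_of_ge hH h']; exact (quantile_mem hH u).2

/-- At `h` the quantile function leaves `0` and takes only values above `x_*` from then on. -/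
theorem quantile_le_iff_of_le_xStar (hH : (H : Measure unitInterval) {0, 1} < 1) {x : ℝ}
    (h0 : 0 ≤ x) (hx : x ≤ xStar H) (u : ℝ) : quantile H u ≤ x ↔ u ≤ massOne H := by
  refine ⟨fun h => not_lt.1 fun hu => h.not_gt ?_, fun h => by rwa [quantile_of_le h]⟩
  refine hx.trans_lt ?_
  rcases lt_or_ge u (mean H) with h' | h'
  · rw [quantile_of_mem ⟨hu, h'⟩]; exact xStar_lt_exp_neg_rate hH ⟨hu, h'⟩
  · rw [quantile_of_ge hH h']; exact xStar_lt_one hH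

theorem quantile_le_iff_of_xStar_lt (hH : (H : Measure unitInterval) {0, 1} < 1) {x : ℝ}
    (hx : x ∈ Ioo (xStar H) 1) (u : ℝ) : quantile H u ≤ x ↔ u ≤ alphaI H x := by
  obtain ⟨hα, hx'⟩ := alphaI_spec hH hx
  have hq : quantile H (alphaI H x) = x := by rw [quantile_of_mem hα, hx']
  refine ⟨fun h => not_lt.1 fun hu => h.not_gt ?_, fun h => (quantile_monotone hH h).trans hq.le⟩
  rcases lt_or_ge u (mean H) with h' | h'
  · have hu' : u ∈ Ioo (massOne H) (mean H) := ⟨hα.1.trans hu, h'⟩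
    rw [← hx', quantile_of_mem hu']
    exact Real.exp_lt_exp.2 (neg_lt_neg (rate_strictAntiOn hH hα hu' hu))
  · rw [quantile_of_ge hH h']; exact hx.2

/-- Lebesgue measure on `(0, 1]`. -/
abbrev unitVolume : Measure ℝ := volume.restrict (Ioc 0 1)

instance : IsProbabilityMeasure unitVolume := ⟨by simp⟩

/-- The quantile function with values in the unit interval. -/
def unitQuantile (H : ProbabilityMeasure unitInterval) (u : ℝ) : unitInterval :=
  projIcc 0 1 zero_le_one (quantile H u)

theorem measurable_unitQuantile (hH : (H : Measure unitInterval) {0, 1} < 1) :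
    Measurable (unitQuantile H) :=
  ((monotone_projIcc _).comp (quantile_monotone hH)).measurable

theorem coe_unitQuantile (hH : (H : Measure unitInterval) {0, 1} < 1) (u : ℝ) :
    (unitQuantile H u : ℝ) = quantile H u := by
  rw [unitQuantile, projIcc_of_mem _ (quantile_mem hH u)]

theorem unitVolume_Iic {a : ℝ} (h0 : 0 ≤ a) (h1 : a ≤ 1) : unitVolume.real {u | u ≤ a} = a := by
  change unitVolume.real (Iic a) = a
  have h : Iic a ∩ Ioc 0 1 = Ioc 0 a := by
    ext u; simp only [mem_inter_iff, mem_Iic, mem_Ioc]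
    exact ⟨fun h => ⟨h.2.1, h.1⟩, fun h => ⟨h.2, h.1, h.2.trans h1⟩⟩
  rw [measureReal_restrict_apply measurableSet_Iic, h]
  simp [h0]

/-- The limit law: the distribution of the quantile function at a uniform random point. -/
def limitLaw (H : ProbabilityMeasure unitInterval) (hH : (H : Measure unitInterval) {0, 1} < 1) :
    ProbabilityMeasure unitInterval :=
  ⟨unitVolume.map (unitQuantile H),
    Measure.isProbabilityMeasure_map (measurable_unitQuantile hH).aemeasurable⟩

theorem isLimitLaw_limitLaw (hH : (H : Measure unitInterval) {0, 1} < 1) :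
    IsLimitLaw H (limitLaw H hH) := by
  have key (x : unitInterval) : (limitLaw H hH : Measure unitInterval).real (Icc 0 x)
      = unitVolume.real {u | quantile H u ≤ x} := by
    change (unitVolume.map (unitQuantile H)).real (Icc 0 x) = _
    rw [map_measureReal_apply (measurable_unitQuantile hH) measurableSet_Icc]
    congr 1
    ext u
    simp only [mem_preimage, mem_Icc, mem_ofPred_eq, ← coe_unitQuantile hH u, Subtype.coe_le_coe]
    exact and_iff_right bot_le
  have h1 := mean_lt_one hH
  refine fun x => ⟨fun hx => ?_, fun hx hx1 => ?_⟩
  · simp_rw [key, quantile_le_iff_of_le_xStar hH x.2.1 hx]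
    exact unitVolume_Iic massOne_nonneg ((massOne_lt_mean hH).trans h1).le
  · simp_rw [key, quantile_le_iff_of_xStar_lt hH ⟨hx, hx1⟩]
    obtain ⟨hα, -⟩ := alphaI_spec hH ⟨hx, hx1⟩
    exact unitVolume_Iic (massOne_nonneg.trans hα.1.le) (hα.2.trans h1).le

theorem IsLimitLaw.unique {g g' : ProbabilityMeasure unitInterval} (hg : IsLimitLaw H g)
    (hg' : IsLimitLaw H g') : g = g' := by
  have := g.2
  have := g'.2
  refine Subtype.ext (Measure.ext_of_Iic _ _ fun x => ?_)
  rw [← measureReal_eq_measureReal_iff]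
  have hIic : Iic x = Icc 0 x := Icc_bot.symm
  rw [hIic]
  rcases le_or_gt (x : ℝ) (xStar H) with h | h
  · exact ((hg x).1 h).trans ((hg' x).1 h).symm
  rcases lt_or_ge (x : ℝ) 1 with h' | h'
  · exact ((hg x).2 h h').trans ((hg' x).2 h h').symm
  -- `IsLimitLaw` says nothing here; the total mass decides.
  · have hx : x = 1 := le_antisymm x.2.2 h'
    have : Icc (0 : unitInterval) 1 = univ := Icc_bot_top
    rw [hx, this]
    simp

end

/-! ### Finite bounds on the break points -/

section

theorem stratBreakPoint_zero_right (p : ℕ → unitInterval) (n : ℕ) : stratBreakPoint p n 0 = 0 :=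
  breakPoint_zero_right _ n

theorem breakPoint_of_lt (p : ℕ → ℕ → unitInterval) {n k : ℕ} (h : n < k) :
    breakPoint p n k = 1 := by
  obtain ⟨k, rfl⟩ := Nat.exists_eq_succ_of_ne_zero (Nat.ne_zero_of_lt h)
  cases n with
  | zero => simp [breakPoint]
  | succ n => rw [breakPoint, if_neg (by omega)]

/-- The value `1` beyond `n + 1` agrees with `P(S_n < k) = 1`, so the recursion holds for all `k`
and inductions need no range condition. -/
theorem stratBreakPoint_succ (p : ℕ → unitInterval) (n k : ℕ) :
    (stratBreakPoint p (n + 1) (k + 1) : ℝ)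
      = p (n + 1) * stratBreakPoint p n k
        + (1 - p (n + 1)) * stratBreakPoint p n (k + 1) := by
  rcases le_or_gt k n with h | h
  · exact breakPoint_rec _ n k h
  · unfold stratBreakPoint
    rw [breakPoint_of_lt _ (by omega), breakPoint_of_lt _ h, breakPoint_of_lt _ (by omega)]
    simp

/-- The moment generating function of the sum of independent Bernoulli variables with parameters
`p 1, …, p n`. -/
def sumMgf (p : ℕ → unitInterval) (n : ℕ) (θ : ℝ) : ℝ :=
  ∏ m ∈ Finset.range n, bernoulliMgf θ (p (m + 1))

theorem sumMgf_succ (p : ℕ → unitInterval) (n : ℕ) (θ : ℝ) :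
    sumMgf p (n + 1) θ = sumMgf p n θ * bernoulliMgf θ (p (n + 1)) :=
  Finset.prod_range_succ _ _

theorem sumMgf_pos (p : ℕ → unitInterval) (n : ℕ) (θ : ℝ) : 0 < sumMgf p n θ :=
  Finset.prod_pos fun _ _ => bernoulliMgf_pos _ _

theorem sumMgf_mono (p : ℕ → unitInterval) (n : ℕ) {θ η : ℝ} (h : θ ≤ η) :
    sumMgf p n θ ≤ sumMgf p n η := by
  refine Finset.prod_le_prod (fun _ _ => (bernoulliMgf_pos _ _).le) fun m _ => ?_
  have := mul_le_mul_of_nonneg_left (Real.exp_le_exp.2 h) (p (m + 1)).2.1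
  unfold bernoulliMgf
  linarith

/-- The Chernoff bound. -/
theorem stratBreakPoint_mul_exp_le (p : ℕ → unitInterval) {θ : ℝ} (hθ : θ ≤ 0) (n k : ℕ) :
    stratBreakPoint p n k * Real.exp (θ * k) ≤ sumMgf p n θ := by
  induction n generalizing k with
  | zero =>
    have h1 : Real.exp (θ * k) ≤ 1 :=
      Real.exp_le_one_iff.2 (mul_nonpos_of_nonpos_of_nonneg hθ k.cast_nonneg)
    simpa [sumMgf] using mul_le_one₀ (stratBreakPoint p 0 k).2.2 (Real.exp_pos _).le h1
  | succ n ih =>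
    cases k with
    | zero => simpa [stratBreakPoint_zero_right] using (sumMgf_pos p (n + 1) θ).le
    | succ k =>
      have hexp : Real.exp (θ * (k + 1 : ℕ)) = Real.exp (θ * k) * Real.exp θ := by
        rw [← Real.exp_add]; push_cast; ring_nf
      have h1 := mul_le_mul_of_nonneg_left (ih k)
        (mul_nonneg (p (n + 1)).2.1 (Real.exp_pos θ).le)
      have h2 := mul_le_mul_of_nonneg_left (ih (k + 1)) (sub_nonneg.2 (p (n + 1)).2.2)
      rw [hexp] at h2
      rw [stratBreakPoint_succ, sumMgf_succ, bernoulliMgf, hexp]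
      linarith

/-- The lower bound accompanying the Chernoff bound: the tilted law puts the mass that is not
accounted for by `stratBreakPoint p n k` on two tails, each bounded by a further tilt. -/
theorem sumMgf_le (p : ℕ → unitInterval) {θ₁ θ θ₂ : ℝ} (h₁ : θ₁ ≤ θ) (h₂ : θ ≤ θ₂) (hθ : θ ≤ 0)
    (n k : ℕ) (b : ℝ) :
    sumMgf p n θ ≤ Real.exp (θ * b) * stratBreakPoint p n k
      + Real.exp ((θ - θ₁) * b) * sumMgf p n θ₁ + Real.exp ((θ - θ₂) * k) * sumMgf p n θ₂ := by
  induction n generalizing k b with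
  | zero =>
    have e₁ := Real.exp_pos (θ * b)
    have e₂ := Real.exp_pos ((θ - θ₁) * b)
    have e₃ := Real.exp_pos ((θ - θ₂) * k)
    cases k with
    | zero => simp [sumMgf, stratBreakPoint_zero_right, e₂.le]
    | succ k =>
      have h1 : stratBreakPoint p 0 (k + 1) = 1 := breakPoint_of_lt _ k.succ_pos
      simp only [sumMgf, h1, Finset.range_zero, Finset.prod_empty, mul_one, Icc.coe_one]
      rcases le_total b 0 with hb | hb
      · linarith [Real.one_le_exp (mul_nonneg_of_nonpos_of_nonpos hθ hb)]
      · linarith [Real.one_le_exp (mul_nonneg (sub_nonneg.2 h₁) hb)]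
  | succ n ih =>
    cases k with
    | zero =>
      have := mul_pos (Real.exp_pos ((θ - θ₁) * b)) (sumMgf_pos p (n + 1) θ₁)
      -- For `k = 0` the upper tail is everything, and its term alone suffices.
      simpa [stratBreakPoint_zero_right] using (sumMgf_mono p (n + 1) h₂).trans (by linarith)
    | succ k =>
      have e1 : Real.exp θ * Real.exp (θ * (b - 1)) = Real.exp (θ * b) := by
        rw [← Real.exp_add]; ring_nf
      have e2 : Real.exp θ * Real.exp ((θ - θ₁) * (b - 1))
          = Real.exp ((θ - θ₁) * b) * Real.exp θ₁ := by
        rw [← Real.exp_add, ← Real.exp_add]; ring_nf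
      have e3 : Real.exp θ * Real.exp ((θ - θ₂) * k)
          = Real.exp ((θ - θ₂) * (k + 1 : ℕ)) * Real.exp θ₂ := by
        rw [← Real.exp_add, ← Real.exp_add]; push_cast; ring_nf
      -- When the last variable is `1`, both thresholds for the remaining sum drop by one; hence the
      -- induction varies `b` along with `k`.
      have h1 := mul_le_mul_of_nonneg_left (ih k (b - 1)) (Real.exp_pos θ).le
      have h1' : Real.exp θ * sumMgf p n θ
          ≤ Real.exp (θ * b) * stratBreakPoint p n k
            + Real.exp ((θ - θ₁) * b) * Real.exp θ₁ * sumMgf p n θ₁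
            + Real.exp ((θ - θ₂) * (k + 1 : ℕ)) * Real.exp θ₂ * sumMgf p n θ₂ := by
        rw [← e1, ← e2, ← e3]; linarith
      have h2 := mul_le_mul_of_nonneg_left h1' (p (n + 1)).2.1
      have h3 := mul_le_mul_of_nonneg_left (ih (k + 1) b) (sub_nonneg.2 (p (n + 1)).2.2)
      rw [stratBreakPoint_succ, sumMgf_succ, sumMgf_succ, sumMgf_succ]
      simp only [bernoulliMgf]
      linarith

theorem integral_empirical {n : ℕ} [NeZero n] (x : Fin n → unitInterval) (f : unitInterval → ℝ) :
    ∫ t, f t ∂(empirical x : Measure unitInterval) = (n : ℝ)⁻¹ * ∑ k : Fin n, f (x k) := by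
  change ∫ t, f t ∂((n : ℝ≥0∞)⁻¹ • ∑ k : Fin n, Measure.dirac (x k)) = _
  rw [integral_smul_measure, integral_finsetSum_measure]
  · simp
  · intro k _
    exact integrable_dirac (by simp)

theorem tendsto_integral_empirical {H : ProbabilityMeasure unitInterval}
    {P : ℕ → ProbabilityMeasure unitInterval} (hP : Tendsto P atTop (𝓝 H))
    {f : unitInterval → ℝ} (hf : Continuous f) :
    Tendsto (fun n => ∫ t, f t ∂(P n : Measure unitInterval)) atTop
      (𝓝 (∫ t, f t ∂(H : Measure unitInterval))) :=
  ProbabilityMeasure.tendsto_iff_forall_integral_tendsto.1 hP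
    (BoundedContinuousFunction.mkOfCompact ⟨f, hf⟩)

theorem tendsto_log_sumMgf {p : ℕ → unitInterval} {H : ProbabilityMeasure unitInterval}
    (hp : Tendsto (fun n : ℕ => propEmpirical p (n + 1)) atTop (𝓝 H)) (θ : ℝ) :
    Tendsto (fun n : ℕ => Real.log (sumMgf p (n + 1) θ) / (n + 1)) atTop (𝓝 (logMgf H θ)) := by
  refine (tendsto_integral_empirical hp (continuous_log_bernoulliMgf θ)).congr fun n => ?_
  rw [propEmpirical, integral_empirical, sumMgf, Real.log_prod
    fun m _ => (bernoulliMgf_pos θ _).ne', Finset.sum_range]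
  push_cast
  ring

end

/-! ### Exponential asymptotics of the break points -/

section

variable {p : ℕ → unitInterval} {H : ProbabilityMeasure unitInterval}

theorem sumMgf_eq_exp (p : ℕ → unitInterval) (n : ℕ) (θ : ℝ) :
    sumMgf p (n + 1) θ = Real.exp ((n + 1) * (Real.log (sumMgf p (n + 1) θ) / (n + 1))) := by
  rw [mul_div_cancel₀ _ (by positivity), Real.exp_log (sumMgf_pos _ _ _)]

theorem exp_rpow_inv (n : ℕ) (x : ℝ) :
    Real.exp ((n + 1) * x) ^ (1 / ((n + 1 : ℕ) : ℝ)) = Real.exp x := by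
  rw [← Real.exp_mul]
  congr 1
  push_cast
  field_simp

/-- The exponential growth rate in the Chernoff bound for `stratBreakPoint p n k`. -/
theorem root_stratBreakPoint_le {θ : ℝ} (hθ : θ ≤ 0) (n k : ℕ) :
    (root (n + 1) (stratBreakPoint p (n + 1) k) : ℝ)
      ≤ Real.exp (Real.log (sumMgf p (n + 1) θ) / (n + 1) - θ * (k / (n + 1))) := by
  rw [← exp_rpow_inv n]
  refine Real.rpow_le_rpow (stratBreakPoint p (n + 1) k).2.1 ?_ (by positivity)
  have h := stratBreakPoint_mul_exp_le p hθ (n + 1) k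
  rw [← le_div_iff₀ (Real.exp_pos _), sumMgf_eq_exp, ← Real.exp_sub] at h
  refine h.trans_eq ?_
  congr 1
  field_simp

theorem eventually_root_lt
    (hp : Tendsto (fun n : ℕ => propEmpirical p (n + 1)) atTop (𝓝 H)) {k : ℕ → ℕ} {u : ℝ}
    (hk : Tendsto (fun n : ℕ => (k n : ℝ) / (n + 1)) atTop (𝓝 u)) {θ y : ℝ} (hθ : θ ≤ 0)
    (hy : Real.exp (logMgf H θ - θ * u) < y) :
    ∀ᶠ n in atTop, (root (n + 1) (stratBreakPoint p (n + 1) (k n)) : ℝ) < y := by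
  have h := (Real.continuous_exp.tendsto _).comp
    ((tendsto_log_sumMgf hp θ).sub (hk.const_mul θ))
  filter_upwards [h.eventually_lt_const hy] with n hn
    using (root_stratBreakPoint_le hθ n (k n)).trans_lt hn

theorem eventually_exp_le_quarter {e : ℕ → ℝ} {c : ℝ} (he : Tendsto e atTop (𝓝 c)) (hc : c < 0) :
    ∀ᶠ n : ℕ in atTop, Real.exp ((n + 1) * e n) ≤ 1 / 4 := by
  have h1 : Tendsto (fun n : ℕ => (n : ℝ) + 1) atTop atTop :=
    tendsto_atTop_add_const_right _ _ tendsto_natCast_atTop_atTop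
  exact (Real.tendsto_exp_atBot.comp (h1.atTop_mul_neg hc he)).eventually_le_const (by norm_num)

/-- Under the tilt by `θ` the events `S < βn` and `S ≥ k n` become exponentially small by `hβ` and
`hu`. At least half of the tilted mass then lies between, where the density of the tilt costs at
most `e^{θβn}`. -/
theorem eventually_lt_root
    (hp : Tendsto (fun n : ℕ => propEmpirical p (n + 1)) atTop (𝓝 H)) {k : ℕ → ℕ} {u : ℝ}
    (hk : Tendsto (fun n : ℕ => (k n : ℝ) / (n + 1)) atTop (𝓝 u)) {θ₁ θ θ₂ β y : ℝ}
    (h₁ : θ₁ ≤ θ) (h₂ : θ ≤ θ₂) (hθ : θ ≤ 0)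
    (hβ : (θ - θ₁) * β + logMgf H θ₁ < logMgf H θ)
    (hu : (θ - θ₂) * u + logMgf H θ₂ < logMgf H θ)
    (hy : y < Real.exp (logMgf H θ - θ * β)) :
    ∀ᶠ n in atTop, y < (root (n + 1) (stratBreakPoint p (n + 1) (k n)) : ℝ) := by
  have tail₁ := eventually_exp_le_quarter
    (((tendsto_log_sumMgf hp θ₁).const_add ((θ - θ₁) * β)).sub (tendsto_log_sumMgf hp θ))
    (sub_neg.2 hβ)
  have tail₂ := eventually_exp_le_quarter
    (((hk.const_mul (θ - θ₂)).add (tendsto_log_sumMgf hp θ₂)).sub (tendsto_log_sumMgf hp θ))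
    (sub_neg.2 hu)
  -- The two tails take at most a quarter each; the remaining factor `1 / 2` disappears under the
  -- root.
  have hlog : Tendsto (fun n : ℕ => Real.log (1 / 2) / ((n : ℝ) + 1)) atTop (𝓝 0) :=
    tendsto_const_nhds.div_atTop
      (tendsto_atTop_add_const_right _ _ tendsto_natCast_atTop_atTop)
  have hmain := (Real.continuous_exp.tendsto _).comp
    (((tendsto_log_sumMgf hp θ).sub_const (θ * β)).add hlog)
  rw [add_zero] at hmain
  filter_upwards [tail₁, tail₂, hmain.eventually_const_lt hy] with n t₁ t₂ hn
  refine hn.trans_le ?_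
  simp only [Function.comp_apply]
  rw [← exp_rpow_inv n]
  refine Real.rpow_le_rpow (Real.exp_pos _).le ?_ (by positivity)
  have hle := sumMgf_le p h₁ h₂ hθ (n + 1) (k n) ((n + 1) * β)
  have hpos := sumMgf_pos p (n + 1) θ
  have e₁ : Real.exp ((θ - θ₁) * ((n + 1) * β)) * sumMgf p (n + 1) θ₁ ≤
      1 / 4 * sumMgf p (n + 1) θ := by
    refine le_trans (le_of_eq ?_) (mul_le_mul_of_nonneg_right t₁ hpos.le)
    rw [sumMgf_eq_exp p n θ, sumMgf_eq_exp p n θ₁, ← Real.exp_add, ← Real.exp_add, Real.log_exp,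
      Real.log_exp]
    congr 1
    field_simp
    ring
  have e₂ : Real.exp ((θ - θ₂) * k n) * sumMgf p (n + 1) θ₂ ≤
      1 / 4 * sumMgf p (n + 1) θ := by
    refine le_trans (le_of_eq ?_) (mul_le_mul_of_nonneg_right t₂ hpos.le)
    rw [sumMgf_eq_exp p n θ, sumMgf_eq_exp p n θ₂, ← Real.exp_add, ← Real.exp_add, Real.log_exp,
      Real.log_exp]
    congr 1
    field_simp
    ring
  have e₃ : Real.exp ((n + 1) * (Real.log (sumMgf p (n + 1) θ) / (n + 1) - θ * β
      + Real.log (1 / 2) / (n + 1))) * Real.exp (θ * ((n + 1) * β))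
      = 1 / 2 * sumMgf p (n + 1) θ := by
    have : 1 / 2 * sumMgf p (n + 1) θ
        = Real.exp (Real.log (1 / 2) + Real.log (sumMgf p (n + 1) θ)) := by
      rw [Real.exp_add, Real.exp_log (by norm_num), Real.exp_log hpos]
    rw [this, ← Real.exp_add]
    congr 1
    field_simp
    ring
  refine le_of_mul_le_mul_right ?_ (Real.exp_pos (θ * ((n + 1) * β)))
  rw [e₃]
  linarith

/-- The minimum treats `u ≥ p̄` together with `u < p̄`: at `p̄` the rate tends to `0` and the limit
is `1`. -/
theorem tendsto_exp_neg_rate (hH : (H : Measure unitInterval) {0, 1} < 1) {u : ℝ}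
    (hu : massOne H < u) :
    Tendsto (fun α => Real.exp (-rate H α)) (𝓝[<] (min u (mean H))) (𝓝 (quantile H u)) := by
  rcases lt_or_ge u (mean H) with h | h
  · rw [min_eq_left h.le, quantile_of_mem ⟨hu, h⟩]
    have hc := (rate_continuousOn hH).continuousAt (Ioo_mem_nhds hu h)
    exact (Real.continuous_exp.tendsto _).comp (hc.neg.tendsto.mono_left nhdsWithin_le_nhds)
  · rw [min_eq_right h, quantile_of_ge hH h]
    have := (Real.continuous_exp.tendsto _).comp (tendsto_rate_mean hH).neg
    rwa [neg_zero, Real.exp_zero] at this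

/-- Strict convexity of `logMgf`, as a bound on its difference quotients. -/
theorem logMgf_lt_of_lt_tiltedMean {θ η β : ℝ} (h : θ < η) (hβ : β < tiltedMean H θ) :
    (η - θ) * β + logMgf H θ < logMgf H η := by
  have h1 := logMgf_ge H θ η
  have h2 := mul_lt_mul_of_pos_left hβ (sub_pos.2 h)
  linarith

theorem logMgf_lt_of_tiltedMean_lt {θ η u : ℝ} (h : θ < η) (hu : tiltedMean H η < u) :
    (θ - η) * u + logMgf H η < logMgf H θ := by
  have h1 := logMgf_ge H η θ
  have h2 := mul_lt_mul_of_pos_left hu (sub_pos.2 h)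
  linarith

theorem tendsto_root_stratBreakPoint (hH : (H : Measure unitInterval) {0, 1} < 1)
    (hp : Tendsto (fun n : ℕ => propEmpirical p (n + 1)) atTop (𝓝 H)) {k : ℕ → ℕ} {u : ℝ}
    (hk : Tendsto (fun n : ℕ => (k n : ℝ) / (n + 1)) atTop (𝓝 u)) (hu : u ≠ massOne H) :
    Tendsto (fun n => (root (n + 1) (stratBreakPoint p (n + 1) (k n)) : ℝ)) atTop
      (𝓝 (quantile H u)) := by
  refine tendsto_order.2 ⟨fun y hy => ?_, fun y hy => ?_⟩
  · rcases hu.lt_or_gt with hu | hu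
    · rw [quantile_of_le hu.le] at hy
      exact Eventually.of_forall fun n => hy.trans_le (root _ _).2.1
    -- Tilt to a mean `α` slightly below `min u p̄`, so that the tilted sum stays below `k n`.
    obtain ⟨α, hyα, hα⟩ := (((tendsto_exp_neg_rate hH hu).eventually_const_lt hy).and
      (Ioo_mem_nhdsLT (lt_min hu (massOne_lt_mean hH)))).exists
    have hα' : α ∈ Ioo (massOne H) (mean H) := ⟨hα.1, hα.2.trans_le (min_le_right _ _)⟩
    have hcont : Tendsto (fun β => Real.exp (logMgf H (theta H α) - theta H α * β)) (𝓝[<] α)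
        (𝓝 (Real.exp (logMgf H (theta H α) - theta H α * α))) :=
      (by fun_prop : Continuous fun β => Real.exp (logMgf H (theta H α) - theta H α * β)).tendsto _
        |>.mono_left nhdsWithin_le_nhds
    have heq : logMgf H (theta H α) - theta H α * α = -rate H α := by rw [rate_eq]; ring
    rw [heq] at hcont
    obtain ⟨β, hyβ, hβ⟩ := ((hcont.eventually_const_lt hyα).and (Ioo_mem_nhdsLT hα.1)).exists
    -- With `β < γ < α < δ < min u p̄`, the tilts `θ(γ)` and `θ(δ)` bound the lower tail at `β` and
    -- the upper tail at `u`.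
    obtain ⟨γ, hγ⟩ := exists_between hβ.2
    obtain ⟨δ, hδ⟩ := exists_between hα.2
    have hγ' : γ ∈ Ioo (massOne H) (mean H) := ⟨hβ.1.trans hγ.1, hγ.2.trans hα'.2⟩
    have hδ' : δ ∈ Ioo (massOne H) (mean H) :=
      ⟨hα.1.trans hδ.1, hδ.2.trans_le (min_le_right _ _)⟩
    have hγα := theta_lt_theta hH hγ' hα' hγ.2
    have hαδ := theta_lt_theta hH hα' hδ' hδ.1
    exact eventually_lt_root hp hk hγα.le hαδ.le (theta_neg hH hα').le
      (logMgf_lt_of_lt_tiltedMean hγα ((tiltedMean_theta hH hγ').symm ▸ hγ.1))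
      (logMgf_lt_of_tiltedMean_lt hαδ
        ((tiltedMean_theta hH hδ').symm ▸ hδ.2.trans_le (min_le_left _ _))) hyβ
  · rcases hu.lt_or_gt with hu | hu
    · rw [quantile_of_le hu.le] at hy
      -- For `u < h` the Chernoff exponent is at most `θ (h - u)`, which is unbounded below as `θ →
      -- -∞`.
      have h1 : Tendsto (fun θ : ℝ => Real.exp (θ * (massOne H - u))) atBot (𝓝 0) :=
        Real.tendsto_exp_atBot.comp (tendsto_id.atBot_mul_const (sub_pos.2 hu))
      obtain ⟨θ, hθ, hθ0⟩ := ((h1.eventually_lt_const hy).and (eventually_le_atBot 0)).exists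
      refine eventually_root_lt hp hk hθ0 (lt_of_le_of_lt (Real.exp_le_exp.2 ?_) hθ)
      linarith [logMgf_le H hθ0]
    rcases lt_or_ge u (mean H) with h | h
    · rw [quantile_of_mem ⟨hu, h⟩, rate_eq] at hy
      refine eventually_root_lt hp hk (theta_neg hH ⟨hu, h⟩).le (lt_of_eq_of_lt ?_ hy)
      congr 1; ring
    · rw [quantile_of_ge hH h] at hy
      exact Eventually.of_forall fun n => (root _ _).2.2.trans_lt hy

theorem tendsto_floor_div {u : ℝ} (hu : 0 ≤ u) :
    Tendsto (fun n : ℕ => ((⌊u * (n + 1)⌋₊ + 1 : ℕ) : ℝ) / (n + 1)) atTop (𝓝 u) := by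
  have h1 : Tendsto (fun n : ℕ => (n : ℝ) + 1) atTop atTop :=
    tendsto_atTop_add_const_right _ _ tendsto_natCast_atTop_atTop
  have h2 := ((tendsto_nat_floor_mul_div_atTop hu).comp h1).add (tendsto_inv_atTop_zero.comp h1)
  rw [add_zero] at h2
  refine h2.congr fun n => ?_
  simp only [Function.comp_apply]
  push_cast
  ring

end

/-! ### Weak convergence of the empirical laws -/

theorem floor_eqOn_Ioo (F : ℕ → ℝ) (k : ℕ) :
    EqOn (fun _ => F k) (fun v : ℝ => F ⌊v⌋₊) (Ioo k (k + 1 : ℕ)) := by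
  intro v hv
  simp only
  rw [(Nat.floor_eq_iff (k.cast_nonneg.trans hv.1.le)).2 ⟨hv.1.le, by exact_mod_cast hv.2⟩]

theorem integral_floor (F : ℕ → ℝ) (n : ℕ) :
    ∫ v in (0 : ℝ)..n, F ⌊v⌋₊ = ∑ k ∈ Finset.range n, F k := by
  have hle (k : ℕ) : (k : ℝ) ≤ (k + 1 : ℕ) := Nat.cast_le.2 k.le_succ
  rw [← Nat.cast_zero, ← intervalIntegral.sum_integral_adjacent_intervals fun k _ => ?_]
  · refine Finset.sum_congr rfl fun k _ => ?_
    rw [intervalIntegral.integral_of_le (hle k), integral_Ioc_eq_integral_Ioo,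
      ← setIntegral_congr_fun measurableSet_Ioo (floor_eqOn_Ioo F k)]
    simp
  · rw [intervalIntegrable_iff_integrableOn_Ioo_of_le (hle k)]
    exact (integrableOn_const (by simp)).congr_fun (floor_eqOn_Ioo F k) measurableSet_Ioo

theorem integral_unitVolume_floor (F : ℕ → ℝ) (n : ℕ) :
    ∫ u, F ⌊u * (n + 1)⌋₊ ∂unitVolume
      = ((n + 1 : ℕ) : ℝ)⁻¹ * ∑ k : Fin (n + 1), F k := by
  rw [← intervalIntegral.integral_of_le zero_le_one,
    intervalIntegral.integral_comp_mul_right (fun v => F ⌊v⌋₊) (by positivity), zero_mul, one_mul,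
    ← Nat.cast_add_one, integral_floor, Finset.sum_range, smul_eq_mul]

theorem tendsto_transformedEmpirical {p : ℕ → unitInterval} {H : ProbabilityMeasure unitInterval}
    (hH : (H : Measure unitInterval) {0, 1} < 1)
    (hp : Tendsto (fun n : ℕ => propEmpirical p (n + 1)) atTop (𝓝 H)) :
    Tendsto (fun n : ℕ => transformedEmpirical p (n + 1)) atTop (𝓝 (limitLaw H hH)) := by
  refine ProbabilityMeasure.tendsto_iff_forall_integral_tendsto.2 fun f => ?_
  have hlim : ∫ t, f t ∂(limitLaw H hH : Measure unitInterval)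
      = ∫ u, f (unitQuantile H u) ∂unitVolume :=
    integral_map (measurable_unitQuantile hH).aemeasurable
      f.continuous.measurable.aestronglyMeasurable
  rw [hlim]
  have hint (n : ℕ) : ∫ u, f (root (n + 1) (stratBreakPoint p (n + 1) (⌊u * (n + 1)⌋₊ + 1)))
      ∂unitVolume = ∫ t, f t ∂(transformedEmpirical p (n + 1) : Measure unitInterval) := by
    rw [transformedEmpirical, integral_empirical]
    exact integral_unitVolume_floor
      (fun k => f (root (n + 1) (stratBreakPoint p (n + 1) (k + 1)))) n
  simp_rw [← hint]
  refine tendsto_integral_of_dominated_convergence (fun _ => ‖f‖) (fun n => ?_)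
    (integrable_const _) (fun n => ae_of_all _ fun u => f.norm_coe_le_norm _) ?_
  · have h1 : Measurable fun u : ℝ => ⌊u * (n + 1)⌋₊ :=
      Nat.measurable_floor.comp (by fun_prop)
    exact ((measurable_of_countable fun k : ℕ =>
      f (root (n + 1) (stratBreakPoint p (n + 1) (k + 1)))).comp h1).aestronglyMeasurable
  -- The point `u = h`, where the limit of the roots is not determined, is a null set.
  · filter_upwards [ae_restrict_mem measurableSet_Ioc,
      ae_restrict_of_ae (Measure.ae_ne volume (massOne H))] with u hu hne
    refine (f.continuous.tendsto _).comp (tendsto_subtype_rng.2 ?_)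
    rw [coe_unitQuantile hH]
    exact tendsto_root_stratBreakPoint hH hp (tendsto_floor_div hu.1.le) hne

end Fragmentation

end

theorem mainTheorem6 (p : ℕ → unitInterval) (H : ProbabilityMeasure unitInterval)
    (hH : (H : Measure unitInterval) {0, 1} < 1)
    (hp : Tendsto (fun n : ℕ => Fragmentation.propEmpirical p (n + 1)) atTop (𝓝 H)) :
    -- the mean lies in `(0, 1)`, and above the mass of `{1}`
    (0 < Fragmentation.mean H ∧ Fragmentation.mean H < 1 ∧
      Fragmentation.massOne H < Fragmentation.mean H) ∧
    -- `θ(α)`, hence `I(α)`, is well defined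
    (∀ α ∈ Ioo (Fragmentation.massOne H) (Fragmentation.mean H),
      ∃! θ : ℝ, Fragmentation.tiltedMean H θ = α) ∧
    -- `I` is continuous and decreasing, with limit `0` at the mean
    ContinuousOn (Fragmentation.rate H)
      (Ioo (Fragmentation.massOne H) (Fragmentation.mean H)) ∧
    StrictAntiOn (Fragmentation.rate H)
      (Ioo (Fragmentation.massOne H) (Fragmentation.mean H)) ∧
    Tendsto (Fragmentation.rate H) (𝓝[<] Fragmentation.mean H) (𝓝 0) ∧
    -- `I` has a limit in `(0, ∞]` at the left endpoint, so that `x_*` is well defined in `[0, 1)`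
    (Tendsto (fun α : ℝ => (Fragmentation.rate H α : EReal)) (𝓝[>] Fragmentation.massOne H)
        (𝓝 (Fragmentation.rateLeft H)) ∧
      0 < Fragmentation.rateLeft H ∧
      Fragmentation.xStar H ∈ Ico (0 : ℝ) 1) ∧
    -- `α_I(x)` is well defined
    (∀ x ∈ Icc (Fragmentation.xStar H) 1, ∃! α : ℝ, Fragmentation.SolvesRate H x α) ∧
    -- the limit law is well defined, and it is the weak limit
    (∃! g : ProbabilityMeasure unitInterval, Fragmentation.IsLimitLaw H g) ∧
    ∀ g : ProbabilityMeasure unitInterval, Fragmentation.IsLimitLaw H g →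
      Tendsto (fun n : ℕ => Fragmentation.transformedEmpirical p (n + 1)) atTop (𝓝 g) := by
  refine ⟨⟨Fragmentation.massOne_nonneg.trans_lt (Fragmentation.massOne_lt_mean hH),
    Fragmentation.mean_lt_one hH, Fragmentation.massOne_lt_mean hH⟩,
    fun α hα => Fragmentation.existsUnique_tiltedMean_eq hH hα,
    Fragmentation.rate_continuousOn hH, Fragmentation.rate_strictAntiOn hH,
    Fragmentation.tendsto_rate_mean hH,
    ⟨Fragmentation.tendsto_rate_rateLeft hH, Fragmentation.rateLeft_pos hH,
      Fragmentation.xStar_nonneg, Fragmentation.xStar_lt_one hH⟩,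
    fun x hx => Fragmentation.existsUnique_solvesRate hH hx,
    ⟨_, Fragmentation.isLimitLaw_limitLaw hH,
      fun g hg => hg.unique (Fragmentation.isLimitLaw_limitLaw hH)⟩, fun g hg => ?_⟩
  rw [hg.unique (Fragmentation.isLimitLaw_limitLaw hH)]
  exact Fragmentation.tendsto_transformedEmpirical hH hp
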